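/- Let $p$ be a prime, $q=p^\gamma$ with $\gamma\ge 1$, and let $K=\mathbf F_q((x))$ be the field of formal Laurent series over $\mathbf F_q$, with the absolute value $|z|=q^{-n}$ for $z=\sum_{i\ge n}a_ix^i$, $a_n\neq 0$ (and $|0|=0$). Let $O=\{t\in K:|t|\le 1\}$, and let $\overline K$ be the completion of an algebraic closure of $K$ with respect to the extended absolute value. Let $X$ be the space of continuous $\mathbf F_q$-linear functions $O\to\overline K$ with the supremum norm. For $i\ge 1$ put $[i]=x^{q^i}-x$ and $D_i=[i][i-1]^q\cdots[1]^{q^{i-1}}$, and put $D_0=1$. The Carlitz polynomials are $f_i=D_i^{-1}e_i$, $i\ge 0$, where $e_0(t)=t$ and, for $i\ge 1$, $e_i(t)=\prod_{m\in\mathbf F_q[x],\ \deg m<i}(t-m)$ (the product includes $m=0$). The Carlitz exponential is $e_C(z)=\sum_{j=0}^\infty z^{q^j}/D_j$. Proposition 3. Let $z\in\overline K$ with $|z|<q^{-1/(q-1)}$. Then the series defining $e_C(tz)$ converges for every $t\in O$, the function $w_z(t)=e_C(tz)$, $t\in O$, belongs to $X$, and its expansion in the Carlitz basis is $$w_z(t)=\sum_{n=0}^\infty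 (e_C(z))^{q^n}f_n(t),\qquad t\in O,$$ where the coefficients $(e_C(z))^{q^n}$ tend to $0$ as $n\to\infty$ and the series converges uniformly on $O$. -/

import Mathlib

noncomputable section

open Filter Topology

namespace Carlitz

/-- `K`: the field of formal Laurent series in `x` over the finite field `F = 𝔽_q`. -/
abbrev K (F : Type*) [Field F] [Fintype F] := LaurentSeries F

/-- The number `q` of elements of the field of constants. -/
abbrev q (F : Type*) [Fintype F] : ℕ := Fintype.card F

lemma one_lt_q (F : Type*) [Field F] [Fintype F] : 1 < (q F : NNReal) := by
  exact_mod_cast Fintype.one_lt_card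

lemma q_ne_zero (F : Type*) [Field F] [Fintype F] : (q F : NNReal) ≠ 0 :=
  (zero_lt_one.trans (one_lt_q F)).ne'

/-- The `x`-adic valuation of `K`, made real-valued by sending `x` to `q⁻¹`. -/
instance rankOne (F : Type*) [Field F] [Fintype F] :
    Valuation.RankOne (Valued.v : Valuation (K F) (WithZero (Multiplicative ℤ))) where
  hom' := (WithZeroMulInt.toNNReal (q_ne_zero F)).comp
    MonoidWithZeroHom.ValueGroup₀.embedding
  strictMono' := (WithZeroMulInt.toNNReal_strictMono (one_lt_q F)).comp
    MonoidWithZeroHom.ValueGroup₀.embedding_strictMono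
  exists_val_nontrivial := by
    refine ⟨HahnSeries.single 1 1, ?_⟩
    rw [LaurentSeries.valuation_single_zpow]
    decide

/-- The absolute value on `K`; its value at `∑_{i ≥ n} a_i x^i` with `a_n ≠ 0` is `q^{-n}`
(see `norm_eq`). -/
instance (F : Type*) [Field F] [Fintype F] : NontriviallyNormedField (K F) :=
  Valued.toNontriviallyNormedField (K F) (WithZero (Multiplicative ℤ))

instance (F : Type*) [Field F] [Fintype F] : IsUltrametricDist (K F) :=
  Valued.instIsUltrametricDist (K F) (WithZero (Multiplicative ℤ))

instance (F : Type*) [Field F] [Fintype F] : CompleteSpace (K F) :=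
  LaurentSeries.instLaurentSeriesComplete

lemma norm_eq {F : Type*} [Field F] [Fintype F] (z : K F) (hz : z ≠ 0) :
    ‖z‖ = (q F : ℝ) ^ (-z.order) := by
  have hv : Valued.v z = WithZero.exp (-z.order) := by
    apply le_antisymm
    · rw [LaurentSeries.valuation_le_iff_coeff_lt_eq_zero]
      exact fun n hn => HahnSeries.coeff_eq_zero_of_lt_order hn
    · by_contra! h
      have h' : Valued.v z ≤ WithZero.exp (-(z.order + 1)) := by
        have hz' : Valued.v z ≠ 0 := by simpa using hz
        rw [← WithZero.exp_log hz', WithZero.exp_lt_exp] at h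
        rw [← WithZero.exp_log hz', WithZero.exp_le_exp]
        omega
      rw [LaurentSeries.valuation_le_iff_coeff_lt_eq_zero] at h'
      exact HahnSeries.coeff_order_eq_zero.not.2 hz (h' _ (by omega))
  have h1 : ‖z‖ = WithZeroMulInt.toNNReal (q_ne_zero F) (Valued.v z) := by
    change ((WithZeroMulInt.toNNReal (q_ne_zero F)
      (MonoidWithZeroHom.ValueGroup₀.embedding (Valued.v.restrict z)) : NNReal) : ℝ) = _
    simp
  rw [h1, hv, WithZeroMulInt.toNNReal_neg_apply _ WithZero.exp_ne_zero]
  exact NNReal.coe_zpow _ _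

/-- `K_ac`: the algebraic closure of `K`, with the absolute value extended from `K`. -/
abbrev Kac (F : Type*) [Field F] [Fintype F] := AlgebraicClosure (K F)

instance (F : Type*) [Field F] [Fintype F] : NormedField (Kac F) :=
  spectralNorm.normedField (K F) (Kac F)

instance (F : Type*) [Field F] [Fintype F] : NormedAlgebra (K F) (Kac F) :=
  spectralNorm.normedAlgebra (K F) (Kac F)

/-- `K̄`: the completion of the algebraic closure of `K`. -/
abbrev Kbar (F : Type*) [Field F] [Fintype F] := UniformSpace.Completion (Kac F)

lemma norm_algebraMap_Kbar {F : Type*} [Field F] [Fintype F] (a : K F) :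
    ‖algebraMap (K F) (Kbar F) a‖ = ‖a‖ := by
  simp

/-- `O`: the ring of integers of `K`. -/
def O (F : Type*) [Field F] [Fintype F] : Set (K F) := {t | ‖t‖ ≤ 1}

/-- The indeterminate `x ∈ K`. -/
def x (F : Type*) [Field F] [Fintype F] : K F := HahnSeries.single 1 1

/-- `[i] = x^{q^i} - x`. -/
def bracket (F : Type*) [Field F] [Fintype F] (i : ℕ) : K F := x F ^ q F ^ i - x F

/-- `D_i = [i] [i-1]^q ⋯ [1]^{q^{i-1}}`, `D_0 = 1`. -/
def D (F : Type*) [Field F] [Fintype F] (i : ℕ) : K F :=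
  ∏ k ∈ Finset.range i, bracket F (i - k) ^ q F ^ k

instance (F : Type*) [Field F] [Fintype F] (i : ℕ) : Fintype (Polynomial.degreeLT F i) :=
  Fintype.ofEquiv (Fin i → F) (Polynomial.degreeLTEquiv F i).toEquiv.symm

/-- `e_i(t) = ∏_{m ∈ 𝔽_q[x], deg m < i} (t - m)`. For `i = 0` the only factor is the one of
`m = 0`, so that `e_0(t) = t` (see `e_zero`). -/
def e {F : Type*} [Field F] [Fintype F] (i : ℕ) (t : K F) : K F :=
  ∏ m : Polynomial.degreeLT F i, (t - Polynomial.aeval (x F) (m : Polynomial F))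

lemma e_zero {F : Type*} [Field F] [Fintype F] (t : K F) : e 0 t = t := by
  have h : ∀ m : Polynomial.degreeLT F 0, (m : Polynomial F) = 0 := fun m => by
    have := Polynomial.mem_degreeLT.1 m.2
    simpa using this
  have hc : Fintype.card (Polynomial.degreeLT F 0) = 1 := by
    rw [Fintype.card_eq_one_iff]
    exact ⟨0, fun y => Subtype.ext (by simpa using h y)⟩
  simp [e, h, hc]

/-- The Carlitz polynomial `f_i = D_i⁻¹ e_i`, as a function on `K`. -/
def f {F : Type*} [Field F] [Fintype F] (i : ℕ) (t : K F) : K F := (D F i)⁻¹ * e i t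

/-- The `j`-th term `z^{q^j} / D_j` of the power series of the Carlitz exponential. -/
def expTerm {F : Type*} [Field F] [Fintype F] (z : Kbar F) (j : ℕ) : Kbar F :=
  z ^ q F ^ j / algebraMap (K F) (Kbar F) (D F j)

/-- The Carlitz exponential `e_C(z) = ∑_{j ≥ 0} z^{q^j} / D_j`. -/
def eC {F : Type*} [Field F] [Fintype F] (z : Kbar F) : Kbar F := ∑' j, expTerm z j

/-- The function `w_z(t) = e_C(t z)`. -/
def w {F : Type*} [Field F] [Fintype F] (z : Kbar F) (t : K F) : Kbar F :=
  eC (algebraMap (K F) (Kbar F) t * z)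

/-- The restriction of `φ` to `O` lies in the space `X` of continuous `𝔽_q`-linear functions
`O → K̄`. -/
structure MemX {F : Type*} [Field F] [Fintype F] (φ : K F → Kbar F) : Prop where
  continuousOn : ContinuousOn φ (O F)
  map_add : ∀ t₁ ∈ O F, ∀ t₂ ∈ O F, φ (t₁ + t₂) = φ t₁ + φ t₂
  map_smul : ∀ β : F, ∀ t ∈ O F, φ (algebraMap F (K F) β * t) =
    algebraMap (K F) (Kbar F) (algebraMap F (K F) β) * φ t

/-- `φ = ∑_{n ≥ 0} c_n f_n` is the expansion of `φ` in the Carlitz basis: the coefficients tend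
to `0` and the series converges to `φ` uniformly on `O`. -/
structure HasCarlitzExpansion {F : Type*} [Field F] [Fintype F] (φ : K F → Kbar F)
    (c : ℕ → Kbar F) : Prop where
  coeff_tendsto : Tendsto c atTop (𝓝 0)
  tendstoUniformlyOn : TendstoUniformlyOn
    (fun N t => ∑ n ∈ Finset.range N, c n * algebraMap (K F) (Kbar F) (f n t)) φ atTop (O F)

end Carlitz

end

noncomputable section

open Filter Topology

namespace Carlitz

/-! Multiplication by `x` acts in the same way on both sides. Since `x^{q^j} = x + [j]` and `[j] /
D_j = 1 / D_{j-1}^q`, the exponential satisfies `e_C(xu) = x e_C(u) + e_C(u)^q` (`eC_X_mul`). The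
Carlitz polynomials satisfy `f_{i+1}(xt) = x f_{i+1}(t) + f_i(t)^q` (`f_X_mul`), so `S(t) = ∑
e_C(z)^{q^n} f_n(t)` obeys `S(xt) = x S(t) + S(t)^q`. Both sides are `𝔽_q`-linear and equal `e_C(z)`
at `t = 1`, where `f_n` vanishes for `n ≥ 1`; hence they agree on `𝔽_q[x]` (`hasSum_aeval`).

Polynomials are dense in `O`, and both sides are continuous there: `|f_n| ≤ 1` on `O` (`norm_f_le`)
and `|e_C(z)| ≤ |z| < 1` (`norm_eC_le`) make the series uniformly convergent. -/

theorem add_pow_card_pow {F R : Type*} [Field F] [Fintype F] [CommRing R] [Nontrivial R]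
    (φ : F →+* R) (a b : R) (n : ℕ) :
    (a + b) ^ q F ^ n = a ^ q F ^ n + b ^ q F ^ n := by
  obtain ⟨p, hp⟩ := CharP.exists F
  obtain ⟨k, hp', hk⟩ := FiniteField.card F p
  have := Fact.mk hp'
  have : CharP R p := charP_of_injective_ringHom φ.injective p
  rw [q, hk, ← pow_mul]
  exact add_pow_char_pow a b p _

theorem sub_pow_card_pow {F R : Type*} [Field F] [Fintype F] [CommRing R] [Nontrivial R]
    (φ : F →+* R) (a b : R) (n : ℕ) :
    (a - b) ^ q F ^ n = a ^ q F ^ n - b ^ q F ^ n := by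
  rw [eq_sub_iff_add_eq, ← add_pow_card_pow φ, sub_add_cancel]

/-- Homogenized form of `∏ (X - c) = X^q - X`, evaluated at `a / b`. -/
theorem prod_sub_smul {F R : Type*} [Field F] [Fintype F] [Field R] [Algebra F R] (a b : R) :
    ∏ c : F, (a - algebraMap F R c * b) = a ^ q F - b ^ (q F - 1) * a := by
  have hq : q F ≠ 0 := Fintype.card_ne_zero
  by_cases hb : b = 0
  · have : q F - 1 ≠ 0 := Nat.sub_ne_zero_of_lt Fintype.one_lt_card
    simp [hb, this]
  have h : ∏ c : F, (Polynomial.X - Polynomial.C c) = Polynomial.X ^ q F - Polynomial.X := by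
    have h1 := FiniteField.X_pow_card_sub_X_natDegree_eq F (Fintype.one_lt_card (α := F))
    have h2 := Polynomial.prod_multiset_X_sub_C_of_monic_of_roots_card_eq
      (p := (Polynomial.X ^ q F - Polynomial.X : Polynomial F))
      (Polynomial.monic_X_pow_sub (by simpa using Fintype.one_lt_card (α := F)))
      (by rw [FiniteField.roots_X_pow_card_sub_X, h1]; rfl)
    rw [FiniteField.roots_X_pow_card_sub_X] at h2
    exact h2
  have h' := congrArg (Polynomial.aeval (a / b)) h
  simp only [map_prod, map_sub, Polynomial.aeval_X, Polynomial.aeval_C, map_pow] at h'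
  calc ∏ c : F, (a - algebraMap F R c * b) = ∏ c : F, ((a / b - algebraMap F R c) * b) := by
        refine Finset.prod_congr rfl fun c _ => ?_
        field_simp
    _ = b ^ q F * ((a / b) ^ q F - a / b) := by
        rw [Finset.prod_mul_distrib, h', mul_comm]; simp
    _ = _ := by
        obtain ⟨m, hm⟩ := Nat.exists_eq_succ_of_ne_zero hq
        rw [hm]
        simp only [Nat.succ_eq_add_one, Nat.add_sub_cancel, div_pow]
        field_simp
        ring

section

variable {F : Type*} [Field F] [Fintype F]

/-! ### Algebra of the polynomials `e_i` -/

theorem D_zero : D F 0 = 1 := by simp [D]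

theorem D_succ (i : ℕ) : D F (i + 1) = bracket F (i + 1) * D F i ^ q F := by
  rw [D, Finset.prod_range_succ', D, ← Finset.prod_pow, mul_comm]
  congr 1
  · simp
  · refine Finset.prod_congr rfl fun k _ => ?_
    rw [← pow_mul, ← pow_succ, Nat.add_sub_add_right]

theorem e_eq_prod (i : ℕ) (t : K F) :
    e i t = ∏ v : Fin i → F, (t - ∑ k, algebraMap F (K F) (v k) * x F ^ (k : ℕ)) := by
  refine Fintype.prod_equiv (Polynomial.degreeLTEquiv F i).toEquiv _ _ fun m => ?_
  obtain ⟨v, rfl⟩ := (Polynomial.degreeLTEquiv F i).symm.surjective m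
  simp only [LinearEquiv.coe_toEquiv, LinearEquiv.apply_symm_apply]
  congr 1
  change Polynomial.aeval (x F) (∑ k : Fin i, Polynomial.monomial k (v k)) = _
  simp [Polynomial.aeval_monomial]

/-- Group the polynomials of degree at most `i` by their coefficient `c` of `x^i`. -/
theorem e_succ_eq_prod (i : ℕ) (t : K F) :
    e (i + 1) t = ∏ c : F, e i (t - algebraMap F (K F) c * x F ^ i) := by
  rw [e_eq_prod, ← (Fin.snocEquiv fun _ => F).prod_comp, Fintype.prod_prod_type]
  refine Finset.prod_congr rfl fun c _ => ?_
  rw [e_eq_prod]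
  refine Finset.prod_congr rfl fun v _ => ?_
  rw [Fin.sum_univ_castSucc]
  simp only [Fin.snocEquiv_apply, Fin.snoc_castSucc, Fin.snoc_last, Fin.val_castSucc, Fin.val_last]
  ring

theorem e_aeval_eq_zero {i : ℕ} {a : Polynomial F} (ha : a ∈ Polynomial.degreeLT F i) :
    e i (Polynomial.aeval (x F) a) = 0 :=
  Finset.prod_eq_zero (Finset.mem_univ ⟨a, ha⟩) (sub_self _)

theorem e_X_pow_eq_zero {i k : ℕ} (h : k < i) : e i (x F ^ k) = 0 := by
  have := e_aeval_eq_zero (F := F) (i := i) (a := Polynomial.X ^ k)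
    (by rw [Polynomial.mem_degreeLT, Polynomial.degree_X_pow]; exact_mod_cast h)
  simpa using this

/-- Linearity of `e_i` turns the product over `c` into the recursion for `e_{i+1}`, and the
recursion passes linearity on, because the `q`-th power is `𝔽_q`-linear. -/
theorem e_linear_and_succ (i : ℕ) :
    (∀ s t : K F, e i (s + t) = e i s + e i t) ∧
    (∀ (c : F) (t : K F), e i (algebraMap F (K F) c * t) = algebraMap F (K F) c * e i t) ∧
    (∀ t : K F, e (i + 1) t = e i t ^ q F - e i (x F ^ i) ^ (q F - 1) * e i t) := by
  have key : ∀ i : ℕ, (∀ s t : K F, e i (s + t) = e i s + e i t) →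
      (∀ (c : F) (t : K F), e i (algebraMap F (K F) c * t) = algebraMap F (K F) c * e i t) →
      ∀ t : K F, e (i + 1) t = e i t ^ q F - e i (x F ^ i) ^ (q F - 1) * e i t := by
    intro i h1 h2 t
    rw [e_succ_eq_prod, ← prod_sub_smul]
    refine Finset.prod_congr rfl fun c _ => ?_
    rw [← h2, eq_sub_iff_add_eq, ← h1, sub_add_cancel]
  suffices h : (∀ s t : K F, e i (s + t) = e i s + e i t) ∧
      (∀ (c : F) (t : K F), e i (algebraMap F (K F) c * t) = algebraMap F (K F) c * e i t) from
    ⟨h.1, h.2, key i h.1 h.2⟩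
  induction i with
  | zero => simp [e_zero]
  | succ i ih =>
    have h := key i ih.1 ih.2
    constructor
    · intro s t
      have := add_pow_card_pow (algebraMap F (K F)) (e i s) (e i t) 1
      rw [pow_one] at this
      rw [h, h, h, ih.1, this]
      ring
    · intro c t
      rw [h, h, ih.2, mul_pow, ← map_pow, FiniteField.pow_card]
      ring

theorem e_add (i : ℕ) (s t : K F) : e i (s + t) = e i s + e i t := (e_linear_and_succ i).1 s t

theorem e_smul (i : ℕ) (c : F) (t : K F) :
    e i (algebraMap F (K F) c * t) = algebraMap F (K F) c * e i t := (e_linear_and_succ i).2.1 c t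

theorem bracket_pow_card (i : ℕ) :
    bracket F i ^ q F = x F ^ q F ^ (i + 1) - x F ^ q F := by
  have := sub_pow_card_pow (algebraMap F (K F)) (x F ^ q F ^ i) (x F) 1
  rw [pow_one] at this
  rw [bracket, this, ← pow_mul, ← pow_succ]

/-- The two claims feed each other: the first at `t = x^i`, where `e_{i+1}` vanishes, evaluates
`e_{i+1}(x^{i+1})`, which is the constant in the recursion giving the first claim at the next index.
-/
theorem e_X_mul_and_e_X_pow (i : ℕ) :
    (∀ t : K F, e (i + 1) (x F * t) = x F * e (i + 1) t + bracket F (i + 1) * e i t ^ q F) ∧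
    e i (x F ^ i) = D F i := by
  induction i with
  | zero =>
    refine ⟨fun t => ?_, by simp [e_zero, D_zero]⟩
    simp only [(e_linear_and_succ 0).2.2, e_zero, bracket]
    ring
  | succ i ih =>
    obtain ⟨h1, h2⟩ := ih
    have hD : e (i + 1) (x F ^ (i + 1)) = D F (i + 1) := by
      rw [pow_succ', h1, e_X_pow_eq_zero (Nat.lt_succ_self i), h2, D_succ]
      ring
    refine ⟨fun t => ?_, hD⟩
    have h3 := (e_linear_and_succ (F := F) i).2.2 t
    rw [h2] at h3
    have hadd := fun a b => add_pow_card_pow (algebraMap F (K F)) a b 1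
    have hsub := fun a b => sub_pow_card_pow (algebraMap F (K F)) a b 1
    simp only [pow_one] at hadd hsub
    have h4 : e (i + 1) t ^ q F = (e i t ^ q F) ^ q F - (D F i ^ q F) ^ (q F - 1) * e i t ^ q F := by
      rw [h3, hsub, mul_pow]
      ring
    have h5 : bracket F (i + 1) ^ q F * (D F i ^ q F) ^ (q F - 1)
        = D F (i + 1) ^ (q F - 1) * bracket F (i + 1) := by
      rw [D_succ, mul_pow]
      rw [← pow_sub_one_mul Fintype.card_ne_zero (bracket F (i + 1))]
      ring
    have h6 : bracket F (i + 1 + 1) = bracket F (i + 1) ^ q F + x F ^ q F - x F := by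
      rw [bracket_pow_card, bracket]
      ring
    rw [(e_linear_and_succ (i + 1)).2.2, (e_linear_and_succ (i + 1)).2.2, hD, h1, hadd, mul_pow,
      mul_pow, h6]
    linear_combination (-bracket F (i + 1) ^ q F) * h4 + e i t ^ q F * h5

/-! ### Absolute values of `[i]` and nonvanishing of `D_i` -/

theorem norm_x : ‖x F‖ = (q F : ℝ)⁻¹ := by
  rw [norm_eq _ (by simp [x]), x, HahnSeries.order_single one_ne_zero, zpow_neg_one]

theorem norm_bracket_succ (i : ℕ) : ‖bracket F (i + 1)‖ = (q F : ℝ)⁻¹ := by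
  have hq : (1 : ℝ) < q F := by exact_mod_cast Fintype.one_lt_card (α := F)
  have h : ‖x F ^ q F ^ (i + 1)‖ < ‖x F‖ := by
    rw [norm_pow, norm_x]
    exact pow_lt_self_of_lt_one₀ (by positivity) (inv_lt_one_of_one_lt₀ hq)
      (Nat.one_lt_pow (by omega) Fintype.one_lt_card)
  rw [bracket, sub_eq_add_neg, IsUltrametricDist.norm_add_eq_max_of_norm_ne_norm
    (by rw [norm_neg]; exact h.ne), norm_neg, max_eq_right h.le, norm_x]

theorem D_ne_zero (i : ℕ) : D F i ≠ 0 := by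
  have hq : (q F : ℝ) ≠ 0 := by exact_mod_cast Fintype.card_ne_zero
  induction i with
  | zero => simp [D_zero]
  | succ i ih =>
    rw [D_succ]
    refine mul_ne_zero (norm_ne_zero_iff.1 ?_) (pow_ne_zero _ ih)
    rw [norm_bracket_succ]
    exact inv_ne_zero hq

/-! ### Carlitz polynomials and their bound on `O` -/

theorem f_zero (t : K F) : f 0 t = t := by simp [f, e_zero, D_zero]

theorem f_add (i : ℕ) (s t : K F) : f i (s + t) = f i s + f i t := by
  rw [f, e_add, mul_add, f, f]

theorem f_smul (i : ℕ) (c : F) (t : K F) :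
    f i (algebraMap F (K F) c * t) = algebraMap F (K F) c * f i t := by
  rw [f, e_smul, f]
  ring

theorem f_succ_one (i : ℕ) : f (i + 1) (1 : K F) = 0 := by
  have := e_X_pow_eq_zero (F := F) (Nat.succ_pos i)
  rw [pow_zero] at this
  rw [f, this, mul_zero]

theorem f_X_mul (i : ℕ) (t : K F) :
    f (i + 1) (x F * t) = x F * f (i + 1) t + f i t ^ q F := by
  have h := D_ne_zero (F := F) (i + 1)
  have h' := D_ne_zero (F := F) i
  have hb : bracket F (i + 1) ≠ 0 := by
    rintro h0
    rw [D_succ, h0, zero_mul] at h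
    exact h rfl
  rw [f, f, f, (e_X_mul_and_e_X_pow i).1, D_succ, mul_pow, inv_pow]
  field_simp

theorem continuous_f (i : ℕ) : Continuous (f i : K F → K F) := by
  unfold f e
  fun_prop

/-- A property of elements of `K` that holds at `1` and is stable under addition, scalars and
multiplication by `x` holds at all polynomials in `x`. -/
theorem aeval_induction {P : K F → Prop} (one : P 1) (add : ∀ s t, P s → P t → P (s + t))
    (smul : ∀ (c : F) t, P t → P (algebraMap F (K F) c * t)) (mul : ∀ t, P t → P (x F * t))
    (a : Polynomial F) : P (Polynomial.aeval (x F) a) := by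
  induction a using Polynomial.induction_on' with
  | add a b ha hb => rw [map_add]; exact add _ _ ha hb
  | monomial n c =>
    rw [Polynomial.aeval_monomial]
    refine smul c _ ?_
    induction n with
    | zero => simpa using one
    | succ n ih => rw [pow_succ']; exact mul _ ih

theorem norm_algebraMap_le (c : F) : ‖algebraMap F (K F) c‖ ≤ 1 := by
  by_cases hc : c = 0
  · simp [hc]
  refine (pow_eq_one_iff_of_nonneg (norm_nonneg _)
    (Nat.sub_ne_zero_of_lt Fintype.one_lt_card : q F - 1 ≠ 0)).1 ?_ |>.le
  rw [← norm_pow, ← map_pow, FiniteField.pow_card_sub_one_eq_one c hc, map_one, norm_one]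

theorem norm_x_le : ‖x F‖ ≤ 1 := by
  rw [norm_x]
  exact inv_le_one_of_one_le₀ (by exact_mod_cast Fintype.card_pos)

theorem norm_add_le_one {s t : K F} (hs : ‖s‖ ≤ 1) (ht : ‖t‖ ≤ 1) : ‖s + t‖ ≤ 1 :=
  (IsUltrametricDist.norm_add_le_max s t).trans (max_le hs ht)

theorem aeval_mem_O (a : Polynomial F) : Polynomial.aeval (x F) a ∈ O F := by
  refine aeval_induction (P := fun t => ‖t‖ ≤ 1) (by simp) (fun _ _ => norm_add_le_one)
    (fun c t ht => ?_) (fun t ht => ?_) a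
  · rw [norm_mul]
    exact mul_le_one₀ (norm_algebraMap_le c) (norm_nonneg _) ht
  · rw [norm_mul]
    exact mul_le_one₀ norm_x_le (norm_nonneg _) ht

theorem norm_f_aeval_le (i : ℕ) (a : Polynomial F) : ‖f i (Polynomial.aeval (x F) a)‖ ≤ 1 := by
  -- All `i` are treated at once, since multiplication by `x` brings in `f_{i-1}`.
  refine aeval_induction (P := fun t => ∀ i, ‖f i t‖ ≤ 1) (fun i => ?_) (fun s t hs ht i => ?_)
    (fun c t ht i => ?_) (fun t ht i => ?_) a i
  · cases i <;> simp [f_zero, f_succ_one]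
  · rw [f_add]
    exact norm_add_le_one (hs i) (ht i)
  · rw [f_smul, norm_mul]
    exact mul_le_one₀ (norm_algebraMap_le c) (norm_nonneg _) (ht i)
  · have h : ‖x F * f i t‖ ≤ 1 := by
      rw [norm_mul]
      exact mul_le_one₀ norm_x_le (norm_nonneg _) (ht i)
    cases i with
    | zero => simpa only [f_zero] using h
    | succ i =>
      rw [f_X_mul]
      refine norm_add_le_one h ?_
      rw [norm_pow]
      exact pow_le_one₀ (norm_nonneg _) (ht i)

theorem order_nonneg_of_mem_O {t : K F} (ht : t ∈ O F) (h0 : t ≠ 0) : 0 ≤ t.order := by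
  have hq : (1 : ℝ) < q F := by exact_mod_cast Fintype.one_lt_card (α := F)
  have h : ‖t‖ ≤ 1 := ht
  rw [norm_eq t h0, ← zpow_zero (q F : ℝ), zpow_le_zpow_iff_right₀ hq] at h
  omega

theorem norm_le_of_coeff_eq_zero {t : K F} {n : ℕ} (h : ∀ k < (n : ℤ), t.coeff k = 0) :
    ‖t‖ ≤ (q F : ℝ)⁻¹ ^ n := by
  have hq : (1 : ℝ) < q F := by exact_mod_cast Fintype.one_lt_card (α := F)
  by_cases h0 : t = 0
  · rw [h0, norm_zero]
    positivity
  rw [norm_eq t h0, inv_pow, ← zpow_natCast, ← zpow_neg, zpow_le_zpow_iff_right₀ hq]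
  by_contra! hlt
  exact HahnSeries.coeff_order_eq_zero.not.2 h0 (h _ (by omega))

theorem exists_tendsto_aeval {t : K F} (ht : t ∈ O F) :
    ∃ a : ℕ → Polynomial F, Tendsto (fun n => Polynomial.aeval (x F) (a n)) atTop (𝓝 t) := by
  have hq : (1 : ℝ) < q F := by exact_mod_cast Fintype.one_lt_card (α := F)
  -- Truncations of the power series of `t`.
  refine ⟨fun n => ∑ k ∈ Finset.range n, Polynomial.monomial k (t.coeff k), ?_⟩
  rw [tendsto_iff_norm_sub_tendsto_zero]
  refine squeeze_zero (fun _ => norm_nonneg _) (fun n => norm_le_of_coeff_eq_zero fun k hk => ?_)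
    (tendsto_pow_atTop_nhds_zero_of_lt_one (by positivity) (inv_lt_one_of_one_lt₀ hq))
  have h1 : Polynomial.aeval (x F) (∑ k ∈ Finset.range n, Polynomial.monomial k (t.coeff k)) =
      ∑ j ∈ Finset.range n, HahnSeries.single (j : ℤ) (t.coeff j) := by
    rw [map_sum]
    refine Finset.sum_congr rfl fun j _ => ?_
    rw [Polynomial.aeval_monomial, x, HahnSeries.single_pow]
    simp [LaurentSeries.algebraMap_apply, HahnSeries.C_apply]
  rw [h1, HahnSeries.coeff_sub, HahnSeries.coeff_sum, sub_eq_zero]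
  by_cases h0 : t = 0
  · simp [h0]
  by_cases hk0 : k < 0
  · rw [HahnSeries.coeff_eq_zero_of_lt_order (hk0.trans_le (order_nonneg_of_mem_O ht h0))]
    exact Finset.sum_eq_zero fun j _ => HahnSeries.coeff_single_of_ne (by omega)
  lift k to ℕ using by omega
  rw [Finset.sum_eq_single_of_mem k (by simpa using hk)]
  · simp
  · exact fun j _ hj => HahnSeries.coeff_single_of_ne (by exact_mod_cast hj.symm)

theorem norm_f_le {t : K F} (ht : t ∈ O F) (i : ℕ) : ‖f i t‖ ≤ 1 := by
  obtain ⟨a, ha⟩ := exists_tendsto_aeval ht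
  exact le_of_tendsto (((continuous_f i).tendsto t).comp ha).norm
    (Eventually.of_forall fun n => norm_f_aeval_le i (a n))

/-! ### Convergence and size of the exponential -/

instance : IsUltrametricDist (Kac F) :=
  IsUltrametricDist.isUltrametricDist_of_isNonarchimedean_norm
    (isNonarchimedean_spectralNorm (K := K F) (L := Kac F))

instance : IsUltrametricDist (Kbar F) :=
  IsUltrametricDist.isUltrametricDist_of_isNonarchimedean_norm fun a b => by
    induction a, b using UniformSpace.Completion.induction_on₂ with
    | hp => exact isClosed_le (by fun_prop) (by fun_prop)
    | ih a b =>
      rw [← UniformSpace.Completion.coe_add]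
      simpa only [UniformSpace.Completion.norm_coe] using IsUltrametricDist.norm_add_le_max a b

variable (F) in
/-- The radius of the disk of convergence of the Carlitz exponential. -/
def expRadius : ℝ := (q F : ℝ) ^ (-1 / ((q F : ℝ) - 1))

theorem one_lt_q_real : (1 : ℝ) < q F := by exact_mod_cast Fintype.one_lt_card (α := F)

theorem expRadius_pos : 0 < expRadius F :=
  Real.rpow_pos_of_pos (zero_lt_one.trans one_lt_q_real) _

theorem expRadius_lt_one : expRadius F < 1 := by
  have h := one_lt_q_real (F := F)
  exact Real.rpow_lt_one_of_one_lt_of_neg h (div_neg_of_neg_of_pos (by norm_num) (by linarith))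

theorem expRadius_pow_card : expRadius F ^ q F = (q F : ℝ)⁻¹ * expRadius F := by
  have h := one_lt_q_real (F := F)
  have h0 : (0 : ℝ) < q F := by linarith
  have h1 : (q F : ℝ) - 1 ≠ 0 := by linarith
  rw [expRadius, ← Real.rpow_natCast, ← Real.rpow_mul h0.le, ← Real.rpow_neg_one,
    ← Real.rpow_add h0]
  congr 1
  field_simp
  ring

/-- With `r` the radius, `|[i+1]| = 1/q` and `r^q = r/q` match the recursion for `D_i`. Hence
`|u^{q^j} / D_j| = r (|u|/r)^{q^j}`, which decays exactly when `|u| < r`. -/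
theorem norm_D_mul_expRadius (i : ℕ) : ‖D F i‖ * expRadius F = expRadius F ^ q F ^ i := by
  induction i with
  | zero => simp [D_zero]
  | succ i ih =>
    rw [D_succ, norm_mul, norm_pow, norm_bracket_succ, pow_succ, pow_mul, ← ih, mul_pow,
      expRadius_pow_card]
    ring

theorem norm_expTerm (u : Kbar F) (j : ℕ) :
    ‖expTerm u j‖ = expRadius F * (‖u‖ / expRadius F) ^ q F ^ j := by
  have h := (expRadius_pos (F := F)).ne'
  have hD : ‖D F j‖ ≠ 0 := norm_ne_zero_iff.2 (D_ne_zero j)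
  rw [expTerm, norm_div, norm_algebraMap_Kbar, norm_pow, div_pow, ← norm_D_mul_expRadius]
  field_simp

theorem le_pow_card (n : ℕ) : n ≤ q F ^ n := (Nat.lt_pow_self Fintype.one_lt_card).le

theorem summable_expTerm {u : Kbar F} (hu : ‖u‖ < expRadius F) : Summable (expTerm u) := by
  have hr := expRadius_pos (F := F)
  have h0 : 0 ≤ ‖u‖ / expRadius F := by positivity
  have h1 : ‖u‖ / expRadius F < 1 := (div_lt_one hr).2 hu
  refine .of_norm_bounded ((summable_geometric_of_lt_one h0 h1).mul_left (expRadius F)) fun j => ?_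
  rw [norm_expTerm]
  exact mul_le_mul_of_nonneg_left (pow_le_pow_of_le_one h0 h1.le (le_pow_card j)) hr.le

/-- By the ultrametric inequality: the term `j = 0` is `u`, and no other term is larger. -/
theorem norm_eC_le {u : Kbar F} (hu : ‖u‖ < expRadius F) : ‖eC u‖ ≤ ‖u‖ := by
  have hr := expRadius_pos (F := F)
  have h0 : 0 ≤ ‖u‖ / expRadius F := by positivity
  have h1 : ‖u‖ / expRadius F < 1 := (div_lt_one hr).2 hu
  refine IsUltrametricDist.norm_tsum_le_of_forall_le_of_nonneg (norm_nonneg _) fun j => ?_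
  calc ‖expTerm u j‖ ≤ expRadius F * (‖u‖ / expRadius F) := by
        rw [norm_expTerm]
        exact mul_le_mul_of_nonneg_left (pow_le_of_le_one h0 h1.le
          (pow_ne_zero _ Fintype.card_ne_zero)) hr.le
    _ = ‖u‖ := mul_div_cancel₀ _ hr.ne'

variable (F) in
/-- The embedding of the field of constants into `K̄`. -/
def constEmbedding : F →+* Kbar F := (algebraMap (K F) (Kbar F)).comp (algebraMap F (K F))

theorem eC_add {u v : Kbar F} (hu : ‖u‖ < expRadius F) (hv : ‖v‖ < expRadius F) :
    eC (u + v) = eC u + eC v := by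
  rw [eC, eC, eC, ← (summable_expTerm hu).tsum_add (summable_expTerm hv)]
  refine tsum_congr fun j => ?_
  rw [expTerm, add_pow_card_pow (constEmbedding F), add_div, expTerm, expTerm]

theorem eC_smul (c : F) (u : Kbar F) : eC (constEmbedding F c * u) = constEmbedding F c * eC u := by
  rw [eC, eC, ← tsum_mul_left]
  refine tsum_congr fun j => ?_
  rw [expTerm, mul_pow, ← map_pow, FiniteField.pow_card_pow, expTerm, mul_div_assoc]

theorem hasSum_pow_card {h : ℕ → Kbar F} {s : Kbar F} (hs : HasSum h s) :
    HasSum (fun n => h n ^ q F) (s ^ q F) := by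
  have hadd := fun a b => add_pow_card_pow (constEmbedding F) a b 1
  simp only [pow_one] at hadd
  exact hs.map (AddMonoidHom.mk' (fun a : Kbar F => a ^ q F) hadd) (continuous_pow (q F))

/-! ### Functional equation and the expansion -/

/-- The `q`-th power is additive and continuous, so it passes through the sum. This serves both the
exponential series and the Carlitz expansion. -/
theorem hasSum_of_recurrence {g h : ℕ → Kbar F} {s c : Kbar F} (hs : HasSum h s)
    (h_zero : g 0 = c * h 0) (h_succ : ∀ n, g (n + 1) = c * h (n + 1) + h n ^ q F) :
    HasSum g (c * s + s ^ q F) := by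
  rw [← hasSum_nat_add_iff' 1]
  have h1 := (hasSum_nat_add_iff' 1).2 (hs.mul_left c)
  convert h1.add (hasSum_pow_card hs) using 1
  · exact funext h_succ
  · simp only [Finset.sum_range_one, h_zero]
    ring

theorem expTerm_X_mul_succ (u : Kbar F) (j : ℕ) :
    expTerm (algebraMap (K F) (Kbar F) (x F) * u) (j + 1) =
      algebraMap (K F) (Kbar F) (x F) * expTerm u (j + 1) + expTerm u j ^ q F := by
  have h := D_ne_zero (F := F) (j + 1)
  rw [D_succ] at h
  have hb := (map_ne_zero (algebraMap (K F) (Kbar F))).2 (left_ne_zero_of_mul h)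
  have hD := (map_ne_zero (algebraMap (K F) (Kbar F))).2 (D_ne_zero (F := F) j)
  have hx : algebraMap (K F) (Kbar F) (x F) ^ q F ^ (j + 1) =
      algebraMap (K F) (Kbar F) (x F) + algebraMap (K F) (Kbar F) (bracket F (j + 1)) := by
    rw [bracket, map_sub, map_pow]
    ring
  rw [expTerm, expTerm, expTerm, D_succ, mul_pow, hx, map_mul, map_pow, div_pow, ← pow_mul,
    ← pow_succ]
  field_simp

theorem eC_X_mul {u : Kbar F} (hu : ‖u‖ < expRadius F) :
    eC (algebraMap (K F) (Kbar F) (x F) * u) =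
      algebraMap (K F) (Kbar F) (x F) * eC u + eC u ^ q F :=
  (hasSum_of_recurrence (summable_expTerm hu).hasSum (by simp [expTerm, D_zero])
    (expTerm_X_mul_succ u)).tsum_eq

theorem norm_algebraMap_mul_lt {t : K F} (ht : t ∈ O F) {z : Kbar F} {r : ℝ} (hz : ‖z‖ < r) :
    ‖algebraMap (K F) (Kbar F) t * z‖ < r := by
  rw [norm_mul, norm_algebraMap_Kbar]
  exact (mul_le_of_le_one_left (norm_nonneg _) ht).trans_lt hz

theorem w_add {z : Kbar F} (hz : ‖z‖ < expRadius F) {s t : K F} (hs : s ∈ O F) (ht : t ∈ O F) :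
    w z (s + t) = w z s + w z t := by
  rw [w, map_add, add_mul, eC_add (norm_algebraMap_mul_lt hs hz) (norm_algebraMap_mul_lt ht hz),
    w, w]

theorem w_smul (z : Kbar F) (c : F) (t : K F) :
    w z (algebraMap F (K F) c * t) = constEmbedding F c * w z t := by
  rw [w, w, ← eC_smul, map_mul, mul_assoc]
  rfl

theorem sub_mem_O {s t : K F} (hs : s ∈ O F) (ht : t ∈ O F) : s - t ∈ O F := by
  rw [sub_eq_add_neg]
  exact norm_add_le_one hs ((norm_neg t).le.trans ht)

theorem norm_w_sub_le {z : Kbar F} (hz : ‖z‖ < expRadius F) {s t : K F} (hs : s ∈ O F)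
    (ht : t ∈ O F) : ‖w z s - w z t‖ ≤ ‖z‖ * ‖s - t‖ := by
  have hst := sub_mem_O hs ht
  have h : w z s - w z t = w z (s - t) := by
    rw [sub_eq_iff_eq_add, ← w_add hz hst ht, sub_add_cancel]
  rw [h, w]
  refine (norm_eC_le (norm_algebraMap_mul_lt hst hz)).trans ?_
  rw [norm_mul, norm_algebraMap_Kbar, mul_comm]

theorem continuousOn_w {z : Kbar F} (hz : ‖z‖ < expRadius F) : ContinuousOn (w z) (O F) := by
  refine LipschitzOnWith.continuousOn (K := ‖z‖₊) (LipschitzOnWith.of_dist_le_mul ?_)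
  intro s hs t ht
  rw [dist_eq_norm, dist_eq_norm]
  exact norm_w_sub_le hz hs ht

theorem hasSum_aeval {z : Kbar F} (hz : ‖z‖ < expRadius F) (a : Polynomial F) :
    HasSum (fun n => eC z ^ q F ^ n *
      algebraMap (K F) (Kbar F) (f n (Polynomial.aeval (x F) a)))
      (w z (Polynomial.aeval (x F) a)) := by
  -- Membership in `O` is carried along to keep `tz` inside the disk of convergence.
  refine (aeval_induction (P := fun t => t ∈ O F ∧
    HasSum (fun n => eC z ^ q F ^ n * algebraMap (K F) (Kbar F) (f n t)) (w z t))
    ?_ ?_ ?_ ?_ a).2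
  · refine ⟨norm_one.le, ?_⟩
    convert hasSum_single 0 fun n hn => ?_ using 1
    · simp [w, f_zero]
    · obtain ⟨m, rfl⟩ := Nat.exists_eq_succ_of_ne_zero hn
      rw [f_succ_one, map_zero, mul_zero]
  · rintro s t ⟨hs, hs'⟩ ⟨ht, ht'⟩
    refine ⟨norm_add_le_one hs ht, ?_⟩
    rw [w_add hz hs ht]
    simpa only [f_add, map_add, mul_add] using hs'.add ht'
  · rintro c t ⟨ht, ht'⟩
    refine ⟨?_, ?_⟩
    · change ‖_‖ ≤ 1
      rw [norm_mul]
      exact mul_le_one₀ (norm_algebraMap_le c) (norm_nonneg _) ht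
    · rw [w_smul]
      refine (congrArg (HasSum · _) (funext fun n => ?_)).mpr (ht'.mul_left (constEmbedding F c))
      rw [f_smul, map_mul]
      exact mul_left_comm _ _ _
  · rintro t ⟨ht, ht'⟩
    refine ⟨?_, ?_⟩
    · change ‖_‖ ≤ 1
      rw [norm_mul]
      exact mul_le_one₀ norm_x_le (norm_nonneg _) ht
    · rw [w, map_mul, mul_assoc, eC_X_mul (norm_algebraMap_mul_lt ht hz)]
      refine hasSum_of_recurrence ht' ?_ fun n => ?_
      · simp only [f_zero, map_mul]
        ring
      · rw [f_X_mul, map_add, map_mul, map_pow, mul_pow, ← pow_mul, ← pow_succ]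
        ring

theorem summable_norm_pow_card_pow {u : Kbar F} (hu : ‖u‖ < 1) :
    Summable fun n => ‖u ^ q F ^ n‖ := by
  refine .of_nonneg_of_le (fun _ => norm_nonneg _) (fun n => ?_)
    (summable_geometric_of_lt_one (norm_nonneg u) hu)
  rw [norm_pow]
  exact pow_le_pow_of_le_one (norm_nonneg u) hu.le (le_pow_card n)

theorem norm_pow_mul_f_le (u : Kbar F) (n : ℕ) {t : K F} (ht : t ∈ O F) :
    ‖u ^ q F ^ n * algebraMap (K F) (Kbar F) (f n t)‖ ≤ ‖u ^ q F ^ n‖ := by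
  rw [norm_mul, norm_algebraMap_Kbar]
  exact mul_le_of_le_one_right (norm_nonneg _) (norm_f_le ht n)

theorem tsum_pow_mul_f_eq {z : Kbar F} (hz : ‖z‖ < expRadius F) {t : K F} (ht : t ∈ O F) :
    ∑' n, eC z ^ q F ^ n * algebraMap (K F) (Kbar F) (f n t) = w z t := by
  have hu : ‖eC z‖ < 1 := ((norm_eC_le hz).trans_lt hz).trans expRadius_lt_one
  have hcont : ContinuousOn
      (fun s => ∑' n, eC z ^ q F ^ n * algebraMap (K F) (Kbar F) (f n s)) (O F) :=
    continuousOn_tsum (fun n => (continuous_const.mul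
      ((continuous_algebraMap (K F) (Kbar F)).comp (continuous_f n))).continuousOn)
      (summable_norm_pow_card_pow hu) fun n s hs => norm_pow_mul_f_le _ n hs
  obtain ⟨a, ha⟩ := exists_tendsto_aeval ht
  -- The approximation must stay in `O`, where continuity of both sides is known.
  have ha' : Tendsto (fun n => Polynomial.aeval (x F) (a n)) atTop (𝓝[O F] t) :=
    tendsto_nhdsWithin_iff.2 ⟨ha, Eventually.of_forall fun n => aeval_mem_O (a n)⟩
  refine tendsto_nhds_unique ((hcont t ht).tendsto.comp ha') ?_
  refine ((continuousOn_w hz t ht).tendsto.comp ha').congr fun n => ?_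
  exact (hasSum_aeval hz (a n)).tsum_eq.symm

end
end Carlitz
end

theorem proposition3 (F : Type*) [Field F] [Fintype F] (z : Carlitz.Kbar F)
    (hz : ‖z‖ < (Carlitz.q F : ℝ) ^ (-1 / ((Carlitz.q F : ℝ) - 1))) :
    (∀ t ∈ Carlitz.O F,
      Summable (Carlitz.expTerm (algebraMap (Carlitz.K F) (Carlitz.Kbar F) t * z))) ∧
    Carlitz.MemX (Carlitz.w z) ∧
    Carlitz.HasCarlitzExpansion (Carlitz.w z) (fun n => Carlitz.eC z ^ Carlitz.q F ^ n) := by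
  have hz' : ‖z‖ < Carlitz.expRadius F := hz
  have hu : ‖Carlitz.eC z‖ < 1 :=
    ((Carlitz.norm_eC_le hz').trans_lt hz').trans Carlitz.expRadius_lt_one
  have hsum := Carlitz.summable_norm_pow_card_pow hu
  refine ⟨fun t ht => Carlitz.summable_expTerm (Carlitz.norm_algebraMap_mul_lt ht hz'),
    ⟨Carlitz.continuousOn_w hz', fun s hs t ht => Carlitz.w_add hz' hs ht,
      fun c t _ => Carlitz.w_smul z c t⟩, ⟨?_, ?_⟩⟩
  · exact tendsto_zero_iff_norm_tendsto_zero.2 hsum.tendsto_atTop_zero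
  · exact (tendstoUniformlyOn_tsum_nat hsum fun n t ht =>
      Carlitz.norm_pow_mul_f_le _ n ht).congr_right fun t ht => Carlitz.tsum_pow_mul_f_eq hz' ht
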